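/- Let $\mathbb{R}_+=(0,\infty)$. For $p\in(1,\infty)$, a measurable function $w:\mathbb{R}\to[0,\infty)$, positive almost everywhere, belongs to the Muckenhoupt class $A_p$ if $$[w]_{A_p}:=\sup_{a<b}\Big(\frac1{b-a}\int_a^b w\,dt\Big)\Big(\frac1{b-a}\int_a^b w^{-\frac1{p-1}}\,dt\Big)^{p-1}<\infty .$$ Let $X_0,X_1$ be Banach spaces that are continuously embedded in one Hausdorff topological vector space $Z$, and let $X_0+X_1\subset Z$ be their sum. For $a\in X_0+X_1$ and $t>0$ put $$K(t,a):=\inf\{\|a_0\|_{X_0}+t\|a_1\|_{X_1}: a=a_0+a_1,\ a_0\in X_0,\ a_1\in X_1\},$$ and for $\phi:\mathbb{R}_+\to\mathbb{R}_+$ put $$\|a\|_{(X_0,X_1)_{\phi,p}}:=\Big(\int_0^\infty\big(\phi(t^{-1})K(t,a)\big)^p\,\frac{dt}{t}\Big)^{1/p},\qquad (X_0,X_1)_{\phi,p}:=\{a\in X_0+X_1:\|a\|_{(X_0,X_1)_{\phi,p}}<\infty\}.$$ For a Banach space $X$, $L_p(\mathbb{R}_+,w\,dt;X)$ consists of the strongly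 measurable $g:\mathbb{R}_+\to X$ with $\|g\|_{L_p(\mathbb{R}_+,w\,dt;X)}:=\big(\int_0^\infty\|g(t)\|_X^p\,w(t)\,dt\big)^{1/p}<\infty$. **Theorem 1.1.** There is a function $C(\cdot,\cdot)$ with finite nonnegative values such that the following holds. Let $p\in(1,\infty)$, $w\in A_p$ and $W(t):=\int_0^t w(s)\,ds$, and let $X_0,X_1,Z$ be as above. Suppose that $u\in L_p(\mathbb{R}_+,w\,dt;X_0)$, $f\in L_p(\mathbb{R}_+,w\,dt;X_1)$, $u_0\in X_0+X_1$, and $$u(t)=u_0+\int_0^t f(s)\,ds\qquad\text{for almost every } t\in\mathbb{R}_+ ,$$ as an identity in $X_0+X_1$, where the integral is a Bochner integral in $X_1$. Then $u_0\in(X_0,X_1)_{W^{1/p},p}$ and $$\|u_0\|_{(X_0,X_1)_{W^{1/p},p}}\le C\big(p,[w]_{A_p}\big)\Big(\|u\|_{L_p(\mathbb{R}_+,w\,dt;X_0)}+\|f\|_{L_p(\mathbb{R}_+,w\,dt;X_1)}\Big).$$ -/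

import Mathlib

open MeasureTheory Set
open scoped ENNReal NNReal

noncomputable section

namespace WeightedTrace

/-- The Muckenhoupt characteristic `[w]_{A_p}` of `w : ℝ → [0, ∞)`: the supremum over all compact
intervals `[a, b]` with `a < b` of
`(⨍_a^b w) * (⨍_a^b w ^ (-1/(p-1))) ^ (p-1)`, with value in `[0, ∞]` (and `0 ^ (-1/(p-1)) = ∞`). -/
def apConst (p : ℝ) (w : ℝ → ℝ≥0) : ℝ≥0∞ :=
  ⨆ (a : ℝ) (b : ℝ) (_ : a < b),
    ((∫⁻ t in Icc a b, (w t : ℝ≥0∞)) / ENNReal.ofReal (b - a)) *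
      ((∫⁻ t in Icc a b, (w t : ℝ≥0∞) ^ (-(1 / (p - 1)))) / ENNReal.ofReal (b - a)) ^ (p - 1)

/-- `w ∈ A_p(ℝ)`. As for every weight, `w` is positive almost everywhere; this only excludes
`w = 0` a.e., for which the product `0 * ∞` in the characteristic has no meaning. -/
structure IsMuckenhoupt (p : ℝ) (w : ℝ → ℝ≥0) : Prop where
  measurable : Measurable w
  ae_pos : ∀ᵐ t : ℝ, 0 < w t
  apConst_lt_top : apConst p w < ∞

/-- `W(t) = ∫_0^t w(s) ds` for `t > 0`. -/
def primitive (w : ℝ → ℝ≥0) (t : ℝ) : ℝ≥0∞ :=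
  ∫⁻ s in Ioc 0 t, (w s : ℝ≥0∞)

/-- The measure `w dt` on `ℝ₊ = (0, ∞)`. -/
def halfLineMeasure (w : ℝ → ℝ≥0) : Measure ℝ :=
  (volume.restrict (Ioi 0)).withDensity fun t => (w t : ℝ≥0∞)

/-- An interpolation couple: `X₀` and `X₁` are continuously embedded in the same topological
vector space `Z`. (Completeness of `X₀`, `X₁` and the Hausdorff property of `Z` are required
where couples are used.) -/
structure InterpolationCouple (X₀ X₁ Z : Type*)
    [NormedAddCommGroup X₀] [NormedSpace ℝ X₀] [NormedAddCommGroup X₁] [NormedSpace ℝ X₁]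
    [AddCommGroup Z] [Module ℝ Z] [TopologicalSpace Z] where
  ι₀ : X₀ →L[ℝ] Z
  ι₁ : X₁ →L[ℝ] Z
  injective₀ : Function.Injective ι₀
  injective₁ : Function.Injective ι₁

namespace InterpolationCouple

variable {X₀ X₁ Z : Type*}
  [NormedAddCommGroup X₀] [NormedSpace ℝ X₀] [NormedAddCommGroup X₁] [NormedSpace ℝ X₁]
  [AddCommGroup Z] [Module ℝ Z] [TopologicalSpace Z]

/-- The sum `X₀ + X₁`, as a subset of `Z`. -/
def sum (E : InterpolationCouple X₀ X₁ Z) : Set Z :=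
  {a | ∃ (x₀ : X₀) (x₁ : X₁), a = E.ι₀ x₀ + E.ι₁ x₁}

/-- The `K`-functional
`K(t, a; X₀, X₁) = inf {‖a₀‖ + t ‖a₁‖ : a = a₀ + a₁, a₀ ∈ X₀, a₁ ∈ X₁}` (it is `∞` off
`X₀ + X₁`). -/
def K (E : InterpolationCouple X₀ X₁ Z) (t : ℝ) (a : Z) : ℝ≥0∞ :=
  ⨅ (x₀ : X₀) (x₁ : X₁) (_ : a = E.ι₀ x₀ + E.ι₁ x₁), ENNReal.ofReal (‖x₀‖ + t * ‖x₁‖)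

/-- The norm of the generalized real interpolation space `(X₀, X₁)_{φ,p}`, `1 ≤ p < ∞`:
`(∫_0^∞ (φ(1/t) K(t, a; X₀, X₁)) ^ p dt/t) ^ (1/p)`, with value in `[0, ∞]`. -/
def interpNorm (E : InterpolationCouple X₀ X₁ Z) (φ : ℝ → ℝ≥0∞) (p : ℝ) (a : Z) : ℝ≥0∞ :=
  (∫⁻ t in Ioi (0 : ℝ), (φ t⁻¹ * E.K t a) ^ p / ENNReal.ofReal t) ^ (1 / p)

/-- The generalized real interpolation space `(X₀, X₁)_{φ,p}`. -/
def interpSpace (E : InterpolationCouple X₀ X₁ Z) (φ : ℝ → ℝ≥0∞) (p : ℝ) : Set Z :=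
  {a | a ∈ E.sum ∧ E.interpNorm φ p a < ∞}

end InterpolationCouple

end WeightedTrace

end

/-!
Averaging `u₀ = u(t) - ∫_0^t f` over `t ∈ (0, s)` gives `K(1/s, u₀) ≤ ⨍_0^s (‖u‖ + ‖f‖)`, so after
the substitution `s = 1/t` the theorem follows from the Hardy inequality
`∫_0^∞ W(s) (⨍_0^s g) ^ p ds/s ≤ C ∫_0^∞ g ^ p w dt`.

For the latter, let `σ = w ^ (-1/(p-1)) dt`. Hölder's inequality on `(s/2, s]` and the `A_p`
condition on `(0, s]` show that `σ(s/2, s]` is at least a fixed fraction of `σ(0, s]`. Hence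
`σ(0, 2⁻ᵐ s]` decays geometrically in `m`, and `∫_0^s τ ^ (-δ) dσ ≤ B s ^ (-δ) σ(0, s]` for some
small `δ > 0`. Inserting the factor `τ ^ (δ/q) τ ^ (-δ/q)`, `q = p/(p-1)`, into Hölder's inequality
for `∫_0^s g` therefore gains a power of `τ/s`, which makes the double integral converge after
Tonelli's theorem.
-/

namespace WeightedTrace

open Filter Topology

variable {p : ℝ} {w : ℝ → ℝ≥0}

section Holder

variable {α : Type*} [MeasurableSpace α] {μ : Measure α}

lemma lintegral_mul_rpow_le_of_weight (hp : 1 < p) {v : α → ℝ≥0} (hv : AEMeasurable v μ)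
    (hv₀ : ∀ᵐ x ∂μ, 0 < v x) {g h : α → ℝ≥0∞} (hg : AEMeasurable g μ) (hh : AEMeasurable h μ) :
    (∫⁻ x, g x * h x ∂μ) ^ p ≤ (∫⁻ x, g x ^ p * v x ∂μ) *
      (∫⁻ x, h x ^ (p / (p - 1)) * (v x : ℝ≥0∞) ^ (-(1 / (p - 1))) ∂μ) ^ (p - 1) := by
  have hp₀ : 0 < p := by linarith
  have hp₁ : 0 < p - 1 := by linarith
  have hv' : AEMeasurable (fun x ↦ (v x : ℝ≥0∞)) μ := hv.coe_nnreal_ennreal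
  have holder := ENNReal.lintegral_mul_le_Lp_mul_Lq μ (Real.HolderConjugate.conjExponent hp)
    (hg.mul (hv'.pow_const (1 / p))) (hh.mul (hv'.pow_const (-(1 / p))))
  have cancel : ∫⁻ x, g x * h x ∂μ = ∫⁻ x, g x * (v x : ℝ≥0∞) ^ (1 / p) *
      (h x * (v x : ℝ≥0∞) ^ (-(1 / p))) ∂μ := by
    refine lintegral_congr_ae ?_
    filter_upwards [hv₀] with x hx
    rw [mul_mul_mul_comm, ← ENNReal.rpow_add _ _ (by simpa using hx.ne') ENNReal.coe_ne_top]
    simp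
  calc (∫⁻ x, g x * h x ∂μ) ^ p
      ≤ ((∫⁻ x, (g x * (v x : ℝ≥0∞) ^ (1 / p)) ^ p ∂μ) ^ (1 / p) *
          (∫⁻ x, (h x * (v x : ℝ≥0∞) ^ (-(1 / p))) ^ (p / (p - 1)) ∂μ) ^
            (1 / (p / (p - 1)))) ^ p := by
        rw [cancel]; gcongr; exact holder
    _ = (∫⁻ x, g x ^ p * v x ∂μ) *
          (∫⁻ x, h x ^ (p / (p - 1)) * (v x : ℝ≥0∞) ^ (-(1 / p) * (p / (p - 1))) ∂μ) ^
            (1 / (p / (p - 1)) * p) := by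
        simp only [ENNReal.mul_rpow_of_nonneg _ _ hp₀.le,
          ENNReal.mul_rpow_of_nonneg _ _ (div_pos hp₀ hp₁).le, ← ENNReal.rpow_mul,
          one_div_mul_cancel hp₀.ne', ENNReal.rpow_one]
    _ = _ := by
        congr <;> field_simp

end Holder

lemma setLIntegral_Ioi_inv (F : ℝ → ℝ≥0∞) :
    ∫⁻ t in Ioi 0, F t⁻¹ / ENNReal.ofReal t = ∫⁻ s in Ioi 0, F s / ENNReal.ofReal s := by
  have deriv (t : ℝ) (ht : t ∈ Ioi 0) : HasDerivWithinAt (·⁻¹) (-(t ^ 2)⁻¹) (Ioi 0) t :=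
    (hasDerivAt_inv (ne_of_gt ht)).hasDerivWithinAt
  have key := lintegral_image_eq_lintegral_abs_deriv_mul measurableSet_Ioi deriv
    inv_injective.injOn fun s ↦ F s / ENNReal.ofReal s
  have image : (·⁻¹) '' Ioi (0 : ℝ) = Ioi 0 := by
    rw [image_inv_eq_inv]
    ext
    simp
  rw [image] at key
  rw [key]
  refine setLIntegral_congr_fun measurableSet_Ioi fun t (ht : 0 < t) ↦ ?_
  have weight : ENNReal.ofReal |-(t ^ 2)⁻¹| * (ENNReal.ofReal t⁻¹)⁻¹ = (ENNReal.ofReal t)⁻¹ := by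
    rw [← ENNReal.ofReal_inv_of_pos (inv_pos.2 ht), ← ENNReal.ofReal_inv_of_pos ht,
      ← ENNReal.ofReal_mul (abs_nonneg _), abs_neg, abs_of_pos (by positivity)]
    congr 1
    field_simp
  simp only [div_eq_mul_inv, ← weight]
  ring

lemma setLIntegral_Ioi_rpow_neg_div {ε τ : ℝ} (hε : 0 < ε) (hτ : 0 < τ) :
    ∫⁻ s in Ioi τ, ENNReal.ofReal s ^ (-ε) / ENNReal.ofReal s =
      ENNReal.ofReal ε⁻¹ * ENNReal.ofReal τ ^ (-ε) := by
  have integrand : ∀ s ∈ Ioi τ, ENNReal.ofReal s ^ (-ε) / ENNReal.ofReal s =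
      ENNReal.ofReal (s ^ (-ε - 1)) := fun s hs ↦ by
    have hs₀ : 0 < s := hτ.trans hs
    rw [ENNReal.ofReal_rpow_of_pos hs₀, ← ENNReal.ofReal_div_of_pos hs₀, Real.rpow_sub_one hs₀.ne']
  rw [setLIntegral_congr_fun measurableSet_Ioi integrand,
    ← ofReal_integral_eq_lintegral_ofReal (integrableOn_Ioi_rpow_of_lt (by linarith) hτ)
      ((ae_restrict_mem measurableSet_Ioi).mono fun s hs ↦
        Real.rpow_nonneg (hτ.trans hs).le _),
    integral_Ioi_rpow_of_lt (by linarith) hτ, ENNReal.ofReal_rpow_of_pos hτ,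
    ← ENNReal.ofReal_mul (by positivity)]
  congr 1
  rw [sub_add_cancel]
  field_simp

lemma lintegral_mul_lintegral_Ioc_eq {k F : ℝ → ℝ≥0∞} (hk : Measurable k)
    (hF : AEMeasurable F (volume.restrict (Ioi 0))) :
    ∫⁻ s in Ioi (0 : ℝ), k s * ∫⁻ τ in Ioc 0 s, F τ =
      ∫⁻ τ in Ioi (0 : ℝ), F τ * ∫⁻ s in Ioi τ, k s := by
  have hmeas : AEMeasurable (fun z : ℝ × ℝ ↦ {z : ℝ × ℝ | z.2 ≤ z.1}.indicator
      (fun z ↦ k z.1 * F z.2) z) ((volume.restrict (Ioi 0)).prod (volume.restrict (Ioi 0))) :=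
    ((hk.comp measurable_fst).aemeasurable.mul hF.comp_snd).indicator
      (measurableSet_le measurable_snd measurable_fst)
  calc ∫⁻ s in Ioi (0 : ℝ), k s * ∫⁻ τ in Ioc 0 s, F τ
      = ∫⁻ s in Ioi (0 : ℝ), ∫⁻ τ in Ioi (0 : ℝ),
          {z : ℝ × ℝ | z.2 ≤ z.1}.indicator (fun z ↦ k z.1 * F z.2) (s, τ) := by
        refine lintegral_congr fun s ↦ ?_
        have hFs : AEMeasurable F (volume.restrict (Ioc 0 s)) :=
          hF.mono_measure (Measure.restrict_mono_set _ Ioc_subset_Ioi_self)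
        rw [← lintegral_const_mul'' _ hFs, ← Ioi_inter_Iic, inter_comm,
          ← setLIntegral_indicator measurableSet_Iic]
        rfl
    _ = ∫⁻ τ in Ioi (0 : ℝ), ∫⁻ s in Ioi (0 : ℝ),
          {z : ℝ × ℝ | z.2 ≤ z.1}.indicator (fun z ↦ k z.1 * F z.2) (s, τ) :=
        lintegral_lintegral_swap hmeas
    _ = ∫⁻ τ in Ioi (0 : ℝ), F τ * ∫⁻ s in Ioi τ, k s := by
        refine setLIntegral_congr_fun measurableSet_Ioi fun τ (hτ : 0 < τ) ↦ ?_
        rw [setLIntegral_congr (Ioi_ae_eq_Ici (a := τ)), ← lintegral_const_mul _ hk,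
          ← inter_eq_left.2 (Ici_subset_Ioi.2 hτ), ← setLIntegral_indicator measurableSet_Ici]
        refine lintegral_congr fun s ↦ ?_
        simp only [indicator_apply, mem_ofPred_eq, mem_Ici, mul_comm]

lemma lintegral_rpow_neg_mul_lintegral_Ioc_mul_rpow {ε : ℝ} (hε : 0 < ε) {F : ℝ → ℝ≥0∞}
    (hF : AEMeasurable F (volume.restrict (Ioi 0))) :
    ∫⁻ s in Ioi (0 : ℝ), ENNReal.ofReal s ^ (-ε) / ENNReal.ofReal s *
      ∫⁻ τ in Ioc 0 s, F τ * ENNReal.ofReal τ ^ ε =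
      ENNReal.ofReal ε⁻¹ * ∫⁻ τ in Ioi (0 : ℝ), F τ := by
  have inner : ∀ τ ∈ Ioi (0 : ℝ), F τ * ENNReal.ofReal τ ^ ε *
      ∫⁻ s in Ioi τ, ENNReal.ofReal s ^ (-ε) / ENNReal.ofReal s =
        ENNReal.ofReal ε⁻¹ * F τ := fun τ hτ ↦ by
    rw [setLIntegral_Ioi_rpow_neg_div hε hτ, mul_mul_mul_comm, mul_comm (ENNReal.ofReal τ ^ ε),
      ← ENNReal.rpow_add _ _ (by simpa using hτ) ENNReal.ofReal_ne_top, neg_add_cancel,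
      ENNReal.rpow_zero, mul_one, mul_comm]
  have hk : Measurable fun s ↦ ENNReal.ofReal s ^ (-ε) / ENNReal.ofReal s :=
    (ENNReal.measurable_ofReal.pow_const _).div ENNReal.measurable_ofReal
  have hFε : AEMeasurable (fun τ ↦ F τ * ENNReal.ofReal τ ^ ε) (volume.restrict (Ioi 0)) :=
    hF.mul (ENNReal.measurable_ofReal.pow_const _).aemeasurable
  rw [lintegral_mul_lintegral_Ioc_eq hk hFε, setLIntegral_congr_fun measurableSet_Ioi inner,
    lintegral_const_mul'' _ hF]

section DyadicDecay

lemma Ioc_subset_iUnion_dyadic {s : ℝ} (hs : 0 < s) :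
    Ioc 0 s ⊆ ⋃ m : ℕ, Ioc (s / 2 ^ (m + 1)) (s / 2 ^ m) := by
  rintro t ⟨ht₀, hts⟩
  obtain ⟨m, hlt, hle⟩ := exists_nat_pow_near_of_lt_one (div_pos ht₀ hs) ((div_le_one hs).2 hts)
    (y := (2⁻¹ : ℝ)) (by norm_num) (by norm_num)
  rw [lt_div_iff₀ hs, inv_pow, inv_mul_eq_div] at hlt
  rw [div_le_iff₀ hs, inv_pow, inv_mul_eq_div] at hle
  exact mem_iUnion.2 ⟨m, hlt, hle⟩

variable {ν : Measure ℝ} {θ : ℝ≥0∞}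

lemma measure_Ioc_div_two_pow_le (hν : ∀ s, 0 < s → ν (Ioc 0 (s / 2)) ≤ θ * ν (Ioc 0 s))
    {s : ℝ} (hs : 0 < s) (m : ℕ) : ν (Ioc 0 (s / 2 ^ m)) ≤ θ ^ m * ν (Ioc 0 s) := by
  induction m with
  | zero => simp
  | succ m ih =>
    calc ν (Ioc 0 (s / 2 ^ (m + 1))) = ν (Ioc 0 (s / 2 ^ m / 2)) := by rw [pow_succ, div_div]
      _ ≤ θ * ν (Ioc 0 (s / 2 ^ m)) := hν _ (by positivity)
      _ ≤ θ * (θ ^ m * ν (Ioc 0 s)) := by gcongr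
      _ = θ ^ (m + 1) * ν (Ioc 0 s) := by ring

lemma ofReal_div_two_pow_rpow_neg {s : ℝ} (hs : 0 < s) (δ : ℝ) (m : ℕ) :
    ENNReal.ofReal (s / 2 ^ m) ^ (-δ) = (2 ^ δ) ^ m * ENNReal.ofReal s ^ (-δ) := by
  have two_rpow : (2 : ℝ≥0∞) ^ δ = ENNReal.ofReal (2 ^ δ) := by
    rw [← ENNReal.ofReal_rpow_of_pos two_pos, ENNReal.ofReal_ofNat]
  rw [two_rpow, ENNReal.ofReal_rpow_of_pos (by positivity), ENNReal.ofReal_rpow_of_pos hs,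
    ← ENNReal.ofReal_pow (by positivity), ← ENNReal.ofReal_mul (by positivity),
    Real.div_rpow hs.le (by positivity), Real.rpow_neg (by positivity : (0 : ℝ) ≤ 2 ^ m),
    div_inv_eq_mul, Real.rpow_pow_comm zero_le_two, mul_comm]

lemma lintegral_Ioc_rpow_neg_le (hν : ∀ s, 0 < s → ν (Ioc 0 (s / 2)) ≤ θ * ν (Ioc 0 s))
    {δ s : ℝ} (hδ : 0 ≤ δ) (hs : 0 < s) :
    ∫⁻ τ in Ioc 0 s, ENNReal.ofReal τ ^ (-δ) ∂ν ≤
      2 ^ δ * (1 - 2 ^ δ * θ)⁻¹ * (ENNReal.ofReal s ^ (-δ) * ν (Ioc 0 s)) := by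
  have shell (m : ℕ) : ∫⁻ τ in Ioc (s / 2 ^ (m + 1)) (s / 2 ^ m), ENNReal.ofReal τ ^ (-δ) ∂ν ≤
      (2 ^ δ * (ENNReal.ofReal s ^ (-δ) * ν (Ioc 0 s))) * (2 ^ δ * θ) ^ m := by
    calc ∫⁻ τ in Ioc (s / 2 ^ (m + 1)) (s / 2 ^ m), ENNReal.ofReal τ ^ (-δ) ∂ν
        ≤ ∫⁻ _ in Ioc (s / 2 ^ (m + 1)) (s / 2 ^ m),
            ENNReal.ofReal (s / 2 ^ (m + 1)) ^ (-δ) ∂ν := by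
          refine setLIntegral_mono measurable_const fun τ hτ ↦ ?_
          rw [ENNReal.rpow_neg, ENNReal.rpow_neg]
          have hτ' := hτ.1.le
          gcongr
      _ ≤ ENNReal.ofReal (s / 2 ^ (m + 1)) ^ (-δ) * ν (Ioc 0 (s / 2 ^ m)) := by
          rw [setLIntegral_const]
          gcongr
          positivity
      _ ≤ (2 ^ δ) ^ (m + 1) * ENNReal.ofReal s ^ (-δ) * (θ ^ m * ν (Ioc 0 s)) := by
          rw [ofReal_div_two_pow_rpow_neg hs]
          gcongr
          exact measure_Ioc_div_two_pow_le hν hs m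
      _ = _ := by ring
  calc ∫⁻ τ in Ioc 0 s, ENNReal.ofReal τ ^ (-δ) ∂ν
      ≤ ∑' m : ℕ, ∫⁻ τ in Ioc (s / 2 ^ (m + 1)) (s / 2 ^ m), ENNReal.ofReal τ ^ (-δ) ∂ν :=
        (lintegral_mono_set (Ioc_subset_iUnion_dyadic hs)).trans (lintegral_iUnion_le _ _)
    _ ≤ ∑' m : ℕ, (2 ^ δ * (ENNReal.ofReal s ^ (-δ) * ν (Ioc 0 s))) * (2 ^ δ * θ) ^ m :=
        ENNReal.tsum_le_tsum shell
    _ = _ := by rw [ENNReal.tsum_mul_left, ENNReal.tsum_geometric]; ring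

lemma exists_pos_rpow_mul_lt_one (hθ : θ < 1) : ∃ δ : ℝ, 0 < δ ∧ 2 ^ δ * θ < 1 := by
  have tendsto : Tendsto (fun δ : ℝ ↦ ENNReal.ofReal (2 ^ δ) * θ) (𝓝[>] 0) (𝓝 θ) := by
    have h := (Real.continuous_const_rpow two_ne_zero).tendsto 0
    rw [Real.rpow_zero] at h
    simpa using ENNReal.Tendsto.mul_const
      (tendsto_nhdsWithin_of_tendsto_nhds (ENNReal.tendsto_ofReal h)) (by simp)
  obtain ⟨δ, hδ, hlt⟩ := (eventually_mem_nhdsWithin.and (tendsto.eventually_lt_const hθ)).exists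
  rw [← ENNReal.ofReal_rpow_of_pos two_pos, ENNReal.ofReal_ofNat] at hlt
  exact ⟨δ, hδ, hlt⟩

lemma measure_Ioc_half_le {K : ℝ≥0∞} {s : ℝ} (hs : 0 < s) (hfin : ν (Ioc 0 s) ≠ ∞)
    (hK : ν (Ioc 0 s) ≤ K * ν (Ioc (s / 2) s)) :
    ν (Ioc 0 (s / 2)) ≤ (1 - K⁻¹) * ν (Ioc 0 s) := by
  have split : ν (Ioc 0 (s / 2)) + ν (Ioc (s / 2) s) = ν (Ioc 0 s) := by
    rw [← measure_union (Ioc_disjoint_Ioc_of_le le_rfl) measurableSet_Ioc,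
      Ioc_union_Ioc_eq_Ioc (by positivity) (by linarith)]
  have upper : K⁻¹ * ν (Ioc 0 s) ≤ ν (Ioc (s / 2) s) := by
    rw [mul_comm, ← div_eq_mul_inv]
    exact ENNReal.div_le_of_le_mul' hK
  have upper_ne_top : ν (Ioc (s / 2) s) ≠ ∞ := ne_top_of_le_ne_top hfin (split ▸ le_add_self)
  rw [ENNReal.sub_mul fun _ _ ↦ hfin, one_mul]
  refine ENNReal.le_sub_of_add_le_right (ne_top_of_le_ne_top upper_ne_top upper) ?_
  exact (add_le_add_right upper _).trans_eq split

end DyadicDecay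

/-- The measure `w ^ (-1/(p-1)) dt`, whose density is the weight dual to `w`; it is infinite on the
zero set of `w`. -/
noncomputable def dualMeasure (p : ℝ) (w : ℝ → ℝ≥0) : Measure ℝ :=
  volume.withDensity fun t ↦ (w t : ℝ≥0∞) ^ (-(1 / (p - 1)))

/-- Calderón weights: the `A_p` condition on the half-line is imposed only on the intervals
`(0, s]`, with constant `A` and cleared of the denominators `s`. These are the weights for which the
Hardy inequality below holds. -/
structure IsCalderonWeight (p : ℝ) (A : ℝ≥0) (w : ℝ → ℝ≥0) : Prop where
  measurable : Measurable w
  ae_pos : ∀ᵐ t ∂volume.restrict (Ioi (0 : ℝ)), 0 < w t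
  primitive_mul_le {s : ℝ} (hs : 0 < s) :
    primitive w s * dualMeasure p w (Ioc 0 s) ^ (p - 1) ≤ A * ENNReal.ofReal s ^ p

lemma IsMuckenhoupt.isCalderonWeight (hp : 1 < p) (hw : IsMuckenhoupt p w) :
    IsCalderonWeight p (apConst p w).toNNReal w where
  measurable := hw.measurable
  ae_pos := ae_restrict_of_ae hw.ae_pos
  primitive_mul_le {s} hs := by
    have hp₁ : 0 ≤ p - 1 := by linarith
    have hs₀ : ENNReal.ofReal s ≠ 0 := by simpa using hs
    have average_le : primitive w s / ENNReal.ofReal s *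
        (dualMeasure p w (Ioc 0 s) / ENNReal.ofReal s) ^ (p - 1) ≤ apConst p w := by
      rw [primitive, dualMeasure, withDensity_apply _ measurableSet_Ioc,
        restrict_Ioc_eq_restrict_Icc, apConst]
      refine le_iSup_of_le (0 : ℝ) (le_iSup₂_of_le s hs ?_)
      rw [sub_zero]
    have split : ENNReal.ofReal s ^ p = ENNReal.ofReal s * ENNReal.ofReal s ^ (p - 1) := by
      rw [← add_sub_cancel 1 p, ENNReal.rpow_add_of_nonneg _ _ zero_le_one hp₁, ENNReal.rpow_one,
        add_sub_cancel]
    have pow_ne_top : ENNReal.ofReal s ^ p ≠ ∞ :=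
      ENNReal.rpow_ne_top_of_nonneg (by linarith) ENNReal.ofReal_ne_top
    rw [ENNReal.div_rpow_of_nonneg _ _ hp₁,
      ← ENNReal.mul_div_mul_comm (.inl hs₀) (.inl ENNReal.ofReal_ne_top), ← split,
      ENNReal.div_le_iff (ENNReal.rpow_pos hs₀.bot_lt ENNReal.ofReal_ne_top).ne'
        pow_ne_top] at average_le
    rwa [ENNReal.coe_toNNReal hw.apConst_lt_top.ne]

namespace IsCalderonWeight

variable {A : ℝ≥0}

lemma lintegral_mul_rpow_le (hp : 1 < p) (hw : IsCalderonWeight p A w) {E : Set ℝ}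
    (hE : MeasurableSet E) (hE₀ : E ⊆ Ioi 0) {g h : ℝ → ℝ≥0∞}
    (hg : AEMeasurable g (volume.restrict (Ioi 0))) (hh : Measurable h) :
    (∫⁻ t in E, g t * h t) ^ p ≤ (∫⁻ t in E, g t ^ p * w t) *
      (∫⁻ t in E, h t ^ (p / (p - 1)) ∂dualMeasure p w) ^ (p - 1) := by
  rw [dualMeasure, setLIntegral_withDensity_eq_setLIntegral_mul _
    (hw.measurable.coe_nnreal_ennreal.pow_const _) (hh.pow_const _) hE, mul_comm (fun t ↦ _ ^ _)]
  exact lintegral_mul_rpow_le_of_weight hp hw.measurable.aemeasurable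
    (ae_restrict_of_ae_restrict_of_subset hE₀ hw.ae_pos)
    (hg.mono_measure (Measure.restrict_mono_set _ hE₀)) hh.aemeasurable

lemma ofReal_sub_rpow_le (hp : 1 < p) (hw : IsCalderonWeight p A w) {a b : ℝ} (ha : 0 ≤ a) :
    ENNReal.ofReal (b - a) ^ p ≤
      (∫⁻ t in Ioc a b, (w t : ℝ≥0∞)) * dualMeasure p w (Ioc a b) ^ (p - 1) := by
  simpa using hw.lintegral_mul_rpow_le hp measurableSet_Ioc (E := Ioc a b)
    (fun t ht ↦ ha.trans_lt ht.1) (g := 1) (h := 1) aemeasurable_const measurable_one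

lemma primitive_mul_dualMeasure_rpow_ne_zero (hp : 1 < p) (hw : IsCalderonWeight p A w) {s : ℝ}
    (hs : 0 < s) :
    primitive w s * dualMeasure p w (Ioc 0 s) ^ (p - 1) ≠ 0 := by
  have lower := hw.ofReal_sub_rpow_le hp (a := 0) (b := s) le_rfl
  rw [sub_zero] at lower
  exact ((ENNReal.rpow_pos (by simpa using hs) ENNReal.ofReal_ne_top).trans_le lower).ne'

lemma primitive_mul_dualMeasure_rpow_ne_top (hp : 1 < p) (hw : IsCalderonWeight p A w) {s : ℝ}
    (hs : 0 < s) :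
    primitive w s * dualMeasure p w (Ioc 0 s) ^ (p - 1) ≠ ∞ :=
  ne_top_of_le_ne_top (ENNReal.mul_ne_top ENNReal.coe_ne_top
    (ENNReal.rpow_ne_top_of_nonneg (by linarith) ENNReal.ofReal_ne_top)) (hw.primitive_mul_le hs)

lemma primitive_ne_zero (hp : 1 < p) (hw : IsCalderonWeight p A w) {s : ℝ} (hs : 0 < s) :
    primitive w s ≠ 0 :=
  left_ne_zero_of_mul (hw.primitive_mul_dualMeasure_rpow_ne_zero hp hs)

lemma primitive_ne_top (hp : 1 < p) (hw : IsCalderonWeight p A w) {s : ℝ} (hs : 0 < s) :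
    primitive w s ≠ ∞ := fun h ↦ by
  have dual_ne_zero := right_ne_zero_of_mul (hw.primitive_mul_dualMeasure_rpow_ne_zero hp hs)
  exact hw.primitive_mul_dualMeasure_rpow_ne_top hp hs (by rw [h, ENNReal.top_mul dual_ne_zero])

lemma dualMeasure_Ioc_ne_top (hp : 1 < p) (hw : IsCalderonWeight p A w) {s : ℝ} (hs : 0 < s) :
    dualMeasure p w (Ioc 0 s) ≠ ∞ := fun h ↦
  hw.primitive_mul_dualMeasure_rpow_ne_top hp hs (by
    rw [h, ENNReal.top_rpow_of_pos (by linarith), ENNReal.mul_top (hw.primitive_ne_zero hp hs)])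

lemma dualMeasure_Ioc_le (hp : 1 < p) (hw : IsCalderonWeight p A w) {s : ℝ} (hs : 0 < s) :
    dualMeasure p w (Ioc 0 s) ≤
      (A * 2 ^ p) ^ (1 / (p - 1)) * dualMeasure p w (Ioc (s / 2) s) := by
  have hp₁ : 0 < p - 1 := by linarith
  have half : ENNReal.ofReal (s / 2) ^ p ≤
      primitive w s * dualMeasure p w (Ioc (s / 2) s) ^ (p - 1) := by
    have h := hw.ofReal_sub_rpow_le hp (a := s / 2) (b := s) (by positivity)
    rw [sub_half] at h
    exact h.trans (mul_le_mul_left (lintegral_mono_set (Ioc_subset_Ioc_left (by positivity))) _)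
  have compare : primitive w s * dualMeasure p w (Ioc 0 s) ^ (p - 1) ≤
      primitive w s * (A * 2 ^ p * dualMeasure p w (Ioc (s / 2) s) ^ (p - 1)) :=
    calc primitive w s * dualMeasure p w (Ioc 0 s) ^ (p - 1)
        ≤ A * ENNReal.ofReal (2 * (s / 2)) ^ p := by
          rw [mul_div_cancel₀ s two_ne_zero]; exact hw.primitive_mul_le hs
      _ = A * 2 ^ p * ENNReal.ofReal (s / 2) ^ p := by
          rw [ENNReal.ofReal_mul zero_le_two, ENNReal.mul_rpow_of_nonneg _ _ (by linarith),
            ENNReal.ofReal_ofNat, mul_assoc]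
      _ ≤ A * 2 ^ p * (primitive w s * dualMeasure p w (Ioc (s / 2) s) ^ (p - 1)) := by gcongr
      _ = _ := by ring
  rw [ENNReal.mul_le_mul_iff_right (hw.primitive_ne_zero hp hs) (hw.primitive_ne_top hp hs)]
    at compare
  rw [← ENNReal.rpow_le_rpow_iff hp₁, ENNReal.mul_rpow_of_nonneg _ _ hp₁.le, ← ENNReal.rpow_mul,
    one_div_mul_cancel hp₁.ne', ENNReal.rpow_one]
  exact compare

lemma exists_dualMeasure_Ioc_half_le (hp : 1 < p) (A : ℝ≥0) :
    ∃ θ : ℝ≥0∞, θ < 1 ∧ ∀ w, IsCalderonWeight p A w → ∀ s, 0 < s →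
      dualMeasure p w (Ioc 0 (s / 2)) ≤ θ * dualMeasure p w (Ioc 0 s) := by
  have ratio_ne_top : ((A : ℝ≥0∞) * 2 ^ p) ^ (1 / (p - 1)) ≠ ∞ :=
    ENNReal.rpow_ne_top_of_nonneg (one_div_nonneg.2 (by linarith)) (ENNReal.mul_ne_top
      ENNReal.coe_ne_top (ENNReal.rpow_ne_top_of_nonneg (by linarith) ENNReal.ofNat_ne_top))
  refine ⟨1 - (((A : ℝ≥0∞) * 2 ^ p) ^ (1 / (p - 1)))⁻¹, ENNReal.sub_lt_self ENNReal.one_ne_top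
    one_ne_zero (ENNReal.inv_ne_zero.2 ratio_ne_top), fun w hw s hs ↦ ?_⟩
  exact measure_Ioc_half_le hs (hw.dualMeasure_Ioc_ne_top hp hs) (hw.dualMeasure_Ioc_le hp hs)

lemma exists_lintegral_rpow_neg_le (hp : 1 < p) (A : ℝ≥0) :
    ∃ (δ : ℝ) (B : ℝ≥0), 0 < δ ∧ ∀ w, IsCalderonWeight p A w → ∀ s, 0 < s →
      ∫⁻ τ in Ioc 0 s, ENNReal.ofReal τ ^ (-δ) ∂dualMeasure p w ≤
        B * (ENNReal.ofReal s ^ (-δ) * dualMeasure p w (Ioc 0 s)) := by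
  obtain ⟨θ, hθ, half_le⟩ := exists_dualMeasure_Ioc_half_le hp A
  obtain ⟨δ, hδ, hδθ⟩ := exists_pos_rpow_mul_lt_one hθ
  have B_ne_top : (2 : ℝ≥0∞) ^ δ * (1 - 2 ^ δ * θ)⁻¹ ≠ ∞ :=
    ENNReal.mul_ne_top (ENNReal.rpow_ne_top_of_nonneg hδ.le ENNReal.ofNat_ne_top)
      (ENNReal.inv_ne_top.2 (tsub_pos_of_lt hδθ).ne')
  refine ⟨δ, (2 ^ δ * (1 - 2 ^ δ * θ)⁻¹).toNNReal, hδ, fun w hw s hs ↦ ?_⟩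
  rw [ENNReal.coe_toNNReal B_ne_top]
  exact lintegral_Ioc_rpow_neg_le (half_le w hw) hδ.le hs

lemma lintegral_Ioc_rpow_le (hp : 1 < p) (hw : IsCalderonWeight p A w) (δ s : ℝ)
    {g : ℝ → ℝ≥0∞} (hg : AEMeasurable g (volume.restrict (Ioi 0))) :
    (∫⁻ τ in Ioc 0 s, g τ) ^ p ≤
      (∫⁻ τ in Ioc 0 s, g τ ^ p * w τ * ENNReal.ofReal τ ^ (δ * (p - 1))) *
        (∫⁻ τ in Ioc 0 s, ENNReal.ofReal τ ^ (-δ) ∂dualMeasure p w) ^ (p - 1) := by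
  have hp₀ : 0 < p := by linarith
  have hp₁ : 0 < p - 1 := by linarith
  set η := δ * (p - 1) / p with hη
  have holder := hw.lintegral_mul_rpow_le hp (E := Ioc 0 s) measurableSet_Ioc Ioc_subset_Ioi_self
    (g := fun τ ↦ g τ * ENNReal.ofReal τ ^ η) (h := fun τ ↦ ENNReal.ofReal τ ^ (-η))
    (hg.mul (ENNReal.measurable_ofReal.pow_const _).aemeasurable)
    (ENNReal.measurable_ofReal.pow_const _)
  have cancel : ∀ τ ∈ Ioc 0 s,
      g τ * ENNReal.ofReal τ ^ η * ENNReal.ofReal τ ^ (-η) = g τ := fun τ hτ ↦ by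
    rw [mul_assoc, ← ENNReal.rpow_add _ _ (by simpa using hτ.1) ENNReal.ofReal_ne_top,
      add_neg_cancel, ENNReal.rpow_zero, mul_one]
  have exponent : η * p = δ * (p - 1) := div_mul_cancel₀ _ hp₀.ne'
  have dual_exponent : -η * (p / (p - 1)) = -δ := by rw [hη]; field_simp
  simp only [setLIntegral_congr_fun measurableSet_Ioc cancel,
    ENNReal.mul_rpow_of_nonneg _ _ hp₀.le, ← ENNReal.rpow_mul, exponent, dual_exponent,
    mul_right_comm _ (ENNReal.ofReal _ ^ (δ * (p - 1)))] at holder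
  exact holder

lemma primitive_mul_laverage_rpow_le (hp : 1 < p) (hw : IsCalderonWeight p A w) {δ : ℝ}
    {B : ℝ≥0∞} {s : ℝ} (hs : 0 < s)
    (hB : ∫⁻ τ in Ioc 0 s, ENNReal.ofReal τ ^ (-δ) ∂dualMeasure p w ≤
      B * (ENNReal.ofReal s ^ (-δ) * dualMeasure p w (Ioc 0 s)))
    {g : ℝ → ℝ≥0∞} (hg : AEMeasurable g (volume.restrict (Ioi 0))) :
    primitive w s * (⨍⁻ τ in Ioc 0 s, g τ ∂volume) ^ p ≤
      A * B ^ (p - 1) * (ENNReal.ofReal s ^ (-(δ * (p - 1))) *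
        ∫⁻ τ in Ioc 0 s, g τ ^ p * w τ * ENNReal.ofReal τ ^ (δ * (p - 1))) := by
  have hp₀ : 0 < p := by linarith
  have hp₁ : 0 < p - 1 := by linarith
  set ε := δ * (p - 1) with hε
  set I := ∫⁻ τ in Ioc 0 s, g τ ^ p * w τ * ENNReal.ofReal τ ^ ε
  set D := dualMeasure p w (Ioc 0 s)
  calc primitive w s * (⨍⁻ τ in Ioc 0 s, g τ ∂volume) ^ p
      = primitive w s * ((∫⁻ τ in Ioc 0 s, g τ) ^ p / ENNReal.ofReal s ^ p) := by
        rw [setLAverage_eq, Real.volume_Ioc, sub_zero, ENNReal.div_rpow_of_nonneg _ _ hp₀.le]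
    _ ≤ primitive w s * (I * (B * (ENNReal.ofReal s ^ (-δ) * D)) ^ (p - 1)
          / ENNReal.ofReal s ^ p) := by
        gcongr
        exact (hw.lintegral_Ioc_rpow_le hp δ s hg).trans (by gcongr)
    _ = primitive w s * D ^ (p - 1) / ENNReal.ofReal s ^ p *
          (B ^ (p - 1) * (ENNReal.ofReal s ^ (-ε) * I)) := by
        simp only [ENNReal.mul_rpow_of_nonneg _ _ hp₁.le, ← ENNReal.rpow_mul, neg_mul, ← hε,
          div_eq_mul_inv]
        ring
    _ ≤ A * (B ^ (p - 1) * (ENNReal.ofReal s ^ (-ε) * I)) := by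
        gcongr
        exact ENNReal.div_le_of_le_mul (hw.primitive_mul_le hs)
    _ = _ := by ring

lemma lintegral_primitive_mul_laverage_rpow_le (hp : 1 < p) (hw : IsCalderonWeight p A w) {δ : ℝ}
    (hδ : 0 < δ) {B : ℝ≥0}
    (hB : ∀ s, 0 < s → ∫⁻ τ in Ioc 0 s, ENNReal.ofReal τ ^ (-δ) ∂dualMeasure p w ≤
      B * (ENNReal.ofReal s ^ (-δ) * dualMeasure p w (Ioc 0 s)))
    {g : ℝ → ℝ≥0∞} (hg : AEMeasurable g (volume.restrict (Ioi 0))) :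
    ∫⁻ s in Ioi (0 : ℝ), primitive w s * (⨍⁻ τ in Ioc 0 s, g τ ∂volume) ^ p / ENNReal.ofReal s ≤
      A * B ^ (p - 1) * ENNReal.ofReal (δ * (p - 1))⁻¹ * ∫⁻ τ in Ioi (0 : ℝ), g τ ^ p * w τ := by
  have hε : 0 < δ * (p - 1) := mul_pos hδ (by linarith)
  set ε := δ * (p - 1)
  have pointwise : ∀ s ∈ Ioi (0 : ℝ),
      primitive w s * (⨍⁻ τ in Ioc 0 s, g τ ∂volume) ^ p / ENNReal.ofReal s ≤
        A * B ^ (p - 1) * (ENNReal.ofReal s ^ (-ε) / ENNReal.ofReal s *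
          ∫⁻ τ in Ioc 0 s, g τ ^ p * w τ * ENNReal.ofReal τ ^ ε) := fun s hs ↦ by
    rw [← ENNReal.mul_div_right_comm, ← mul_div_assoc]
    refine ENNReal.div_le_div_right ?_ _
    exact hw.primitive_mul_laverage_rpow_le hp hs (hB s hs) hg
  calc ∫⁻ s in Ioi (0 : ℝ), primitive w s * (⨍⁻ τ in Ioc 0 s, g τ ∂volume) ^ p / ENNReal.ofReal s
      ≤ ∫⁻ s in Ioi (0 : ℝ), A * B ^ (p - 1) * (ENNReal.ofReal s ^ (-ε) / ENNReal.ofReal s *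
          ∫⁻ τ in Ioc 0 s, g τ ^ p * w τ * ENNReal.ofReal τ ^ ε) :=
        setLIntegral_mono' measurableSet_Ioi pointwise
    _ = A * B ^ (p - 1) * ∫⁻ s in Ioi (0 : ℝ), ENNReal.ofReal s ^ (-ε) / ENNReal.ofReal s *
          ∫⁻ τ in Ioc 0 s, g τ ^ p * w τ * ENNReal.ofReal τ ^ ε :=
        lintegral_const_mul' _ _ (ENNReal.mul_ne_top ENNReal.coe_ne_top
          (ENNReal.rpow_ne_top_of_nonneg (by linarith) ENNReal.coe_ne_top))
    _ = _ := by
        rw [lintegral_rpow_neg_mul_lintegral_Ioc_mul_rpow hε (F := fun τ ↦ g τ ^ p * w τ)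
          ((hg.pow_const p).mul hw.measurable.coe_nnreal_ennreal.aemeasurable), ← mul_assoc]

lemma restrict_Ioi_absolutelyContinuous (hw : IsCalderonWeight p A w) :
    volume.restrict (Ioi 0) ≪ halfLineMeasure w := by
  refine withDensity_absolutelyContinuous' hw.measurable.coe_nnreal_ennreal.aemeasurable ?_
  filter_upwards [hw.ae_pos] with t ht
  simpa using ht.ne'

lemma exists_hardy_const (hp : 1 < p) (A : ℝ≥0) :
    ∃ C : ℝ≥0, ∀ w, IsCalderonWeight p A w → ∀ g : ℝ → ℝ≥0∞,
      AEMeasurable g (volume.restrict (Ioi 0)) →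
      (∫⁻ s in Ioi (0 : ℝ), (primitive w s ^ (1 / p) * (⨍⁻ τ in Ioc 0 s, g τ ∂volume)) ^ p /
        ENNReal.ofReal s) ^ (1 / p) ≤ C * eLpNorm g (ENNReal.ofReal p) (halfLineMeasure w) := by
  have hp₀ : 0 < p := by linarith
  obtain ⟨δ, B, hδ, hB⟩ := exists_lintegral_rpow_neg_le hp A
  refine ⟨(A * B ^ (p - 1) * (δ * (p - 1))⁻¹.toNNReal) ^ (1 / p), fun w hw g hg ↦ ?_⟩
  have norm_eq : eLpNorm g (ENNReal.ofReal p) (halfLineMeasure w) =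
      (∫⁻ τ in Ioi (0 : ℝ), g τ ^ p * w τ) ^ (1 / p) := by
    rw [eLpNorm_eq_lintegral_rpow_enorm_toReal (by simpa using hp₀) ENNReal.ofReal_ne_top,
      ENNReal.toReal_ofReal hp₀.le, halfLineMeasure, lintegral_withDensity_eq_lintegral_mul₀
        hw.measurable.coe_nnreal_ennreal.aemeasurable (hg.enorm.pow_const p), mul_comm]
    rfl
  simp only [ENNReal.mul_rpow_of_nonneg _ _ hp₀.le, ← ENNReal.rpow_mul,
    one_div_mul_cancel hp₀.ne', ENNReal.rpow_one]
  rw [norm_eq, ENNReal.coe_rpow_of_nonneg _ (by positivity), ENNReal.coe_mul, ENNReal.coe_mul,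
    ENNReal.coe_rpow_of_nonneg _ (by linarith), ← ENNReal.mul_rpow_of_nonneg _ _ (by positivity)]
  gcongr
  exact hw.lintegral_primitive_mul_laverage_rpow_le hp hδ (hB w hw) hg

end IsCalderonWeight

namespace InterpolationCouple

variable {X₀ X₁ Z : Type*}
  [NormedAddCommGroup X₀] [NormedSpace ℝ X₀] [NormedAddCommGroup X₁] [NormedSpace ℝ X₁]
  [AddCommGroup Z] [Module ℝ Z] [TopologicalSpace Z] (E : InterpolationCouple X₀ X₁ Z)

lemma interpNorm_eq (φ : ℝ → ℝ≥0∞) (p : ℝ) (a : Z) : E.interpNorm φ p a =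
    (∫⁻ s in Ioi (0 : ℝ), (φ s * E.K s⁻¹ a) ^ p / ENNReal.ofReal s) ^ (1 / p) := by
  rw [interpNorm, ← setLIntegral_Ioi_inv]
  simp only [inv_inv]

lemma K_le {t : ℝ} (ht : 0 ≤ t) {a : Z} {x₀ : X₀} {x₁ : X₁} (h : a = E.ι₀ x₀ + E.ι₁ x₁) :
    E.K t a ≤ ‖x₀‖ₑ + ENNReal.ofReal t * ‖x₁‖ₑ := by
  refine (iInf₂_le_of_le x₀ x₁ (iInf_le _ h)).trans_eq ?_
  rw [ENNReal.ofReal_add (norm_nonneg _) (by positivity), ENNReal.ofReal_mul ht,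
    ofReal_norm, ofReal_norm]

variable {E} {u : ℝ → X₀} {f : ℝ → X₁} {u₀ : Z}

lemma eq_add_neg_integral {t : ℝ} (h : E.ι₀ (u t) = u₀ + E.ι₁ (∫ s in (0 : ℝ)..t, f s)) :
    u₀ = E.ι₀ (u t) + E.ι₁ (-∫ s in (0 : ℝ)..t, f s) := by
  rw [h, map_neg, add_neg_cancel_right]

lemma mem_sum_of_ae_eq (h : ∀ᵐ t ∂volume.restrict (Ioi (0 : ℝ)),
    E.ι₀ (u t) = u₀ + E.ι₁ (∫ s in (0 : ℝ)..t, f s)) : u₀ ∈ E.sum := by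
  have : (ae (volume.restrict (Ioi (0 : ℝ)))).NeBot := ae_neBot.2 (by simp)
  obtain ⟨t, ht⟩ := h.exists
  exact ⟨_, _, eq_add_neg_integral ht⟩

lemma K_inv_le_laverage (hu : AEMeasurable (fun t ↦ ‖u t‖ₑ) (volume.restrict (Ioi 0)))
    (h : ∀ᵐ t ∂volume.restrict (Ioi (0 : ℝ)), E.ι₀ (u t) = u₀ + E.ι₁ (∫ s in (0 : ℝ)..t, f s))
    {s : ℝ} (hs : 0 < s) : E.K s⁻¹ u₀ ≤ ⨍⁻ τ in Ioc 0 s, (‖u τ‖ₑ + ‖f τ‖ₑ) ∂volume := by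
  have pointwise : ∀ᵐ τ ∂volume.restrict (Ioc 0 s),
      E.K s⁻¹ u₀ ≤ ‖u τ‖ₑ + ⨍⁻ σ in Ioc 0 s, ‖f σ‖ₑ ∂volume := by
    filter_upwards [ae_restrict_of_ae_restrict_of_subset Ioc_subset_Ioi_self h,
      ae_restrict_mem measurableSet_Ioc] with τ hτ hmem
    refine (E.K_le (inv_nonneg.2 hs.le) (eq_add_neg_integral hτ)).trans ?_
    rw [enorm_neg, intervalIntegral.integral_of_le hmem.1.le, setLAverage_eq, Real.volume_Ioc,
      sub_zero, ENNReal.ofReal_inv_of_pos hs, mul_comm, ← div_eq_mul_inv]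
    gcongr
    exact (enorm_integral_le_lintegral_enorm _).trans
      (lintegral_mono_set (Ioc_subset_Ioc_right hmem.2))
  have hvol : volume (Ioc 0 s) ≠ 0 := by simpa using hs
  calc E.K s⁻¹ u₀ = ⨍⁻ _ in Ioc 0 s, E.K s⁻¹ u₀ ∂volume :=
        (setLAverage_const hvol measure_Ioc_lt_top.ne _).symm
    _ ≤ ⨍⁻ τ in Ioc 0 s, (‖u τ‖ₑ + ⨍⁻ σ in Ioc 0 s, ‖f σ‖ₑ ∂volume) ∂volume :=
        laverage_mono_ae pointwise
    _ = ⨍⁻ τ in Ioc 0 s, (‖u τ‖ₑ + ‖f τ‖ₑ) ∂volume := by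
        have hu' : AEMeasurable (fun t ↦ ‖u t‖ₑ) (volume.restrict (Ioc 0 s)) :=
          hu.mono_measure (Measure.restrict_mono_set _ Ioc_subset_Ioi_self)
        simp only [laverage, lintegral_add_left' (hu'.smul_measure _)]
        congr 1
        exact setLAverage_const hvol measure_Ioc_lt_top.ne _

lemma interpNorm_le_of_ae_eq {φ : ℝ → ℝ≥0∞} {p : ℝ} (hp : 0 ≤ p)
    (hu : AEMeasurable (fun t ↦ ‖u t‖ₑ) (volume.restrict (Ioi 0)))
    (h : ∀ᵐ t ∂volume.restrict (Ioi (0 : ℝ)), E.ι₀ (u t) = u₀ + E.ι₁ (∫ s in (0 : ℝ)..t, f s)) :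
    E.interpNorm φ p u₀ ≤ (∫⁻ s in Ioi (0 : ℝ),
      (φ s * ⨍⁻ τ in Ioc 0 s, (‖u τ‖ₑ + ‖f τ‖ₑ) ∂volume) ^ p / ENNReal.ofReal s) ^ (1 / p) := by
  rw [E.interpNorm_eq]
  refine ENNReal.rpow_le_rpow (setLIntegral_mono' measurableSet_Ioi fun s hs ↦ ?_) (by positivity)
  gcongr
  exact K_inv_le_laverage hu h hs

end InterpolationCouple

end WeightedTrace

theorem theorem1p1_general :
    ∃ C : ℝ → ℝ≥0 → ℝ≥0,
      ∀ (p : ℝ), 1 < p →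
      ∀ (A : ℝ≥0) (w : ℝ → ℝ≥0), WeightedTrace.IsCalderonWeight p A w →
      ∀ (X₀ X₁ Z : Type*)
        [NormedAddCommGroup X₀] [NormedSpace ℝ X₀]
        [NormedAddCommGroup X₁] [NormedSpace ℝ X₁] [CompleteSpace X₁]
        [AddCommGroup Z] [Module ℝ Z] [TopologicalSpace Z]
        (E : WeightedTrace.InterpolationCouple X₀ X₁ Z)
        (u : ℝ → X₀) (f : ℝ → X₁) (u₀ : Z),
        MemLp u (ENNReal.ofReal p) (WeightedTrace.halfLineMeasure w) →
        MemLp f (ENNReal.ofReal p) (WeightedTrace.halfLineMeasure w) →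
        (∀ᵐ t ∂(volume.restrict (Ioi (0 : ℝ))),
          E.ι₀ (u t) = u₀ + E.ι₁ (∫ s in (0 : ℝ)..t, f s)) →
        u₀ ∈ E.interpSpace (fun t ↦ WeightedTrace.primitive w t ^ (1 / p)) p ∧
        E.interpNorm (fun t ↦ WeightedTrace.primitive w t ^ (1 / p)) p u₀ ≤
          C p A * (eLpNorm u (ENNReal.ofReal p) (WeightedTrace.halfLineMeasure w) +
            eLpNorm f (ENNReal.ofReal p) (WeightedTrace.halfLineMeasure w)) := by
  choose! C hardy using fun (p : ℝ) (hp : 1 < p) (A : ℝ≥0) ↦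
    WeightedTrace.IsCalderonWeight.exists_hardy_const hp A
  refine ⟨C, fun p hp A w hw X₀ X₁ Z _ _ _ _ _ _ _ _ E u f u₀ hu hf h ↦ ?_⟩
  have hu' := (hu.1.mono_ac hw.restrict_Ioi_absolutelyContinuous).enorm
  have hf' := (hf.1.mono_ac hw.restrict_Ioi_absolutelyContinuous).enorm
  have minkowski : eLpNorm (fun τ ↦ ‖u τ‖ₑ + ‖f τ‖ₑ) (ENNReal.ofReal p)
      (WeightedTrace.halfLineMeasure w) ≤
        eLpNorm u (ENNReal.ofReal p) (WeightedTrace.halfLineMeasure w) +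
          eLpNorm f (ENNReal.ofReal p) (WeightedTrace.halfLineMeasure w) := by
    rw [← eLpNorm_enorm u, ← eLpNorm_enorm f]
    exact eLpNorm_add_le (f := fun τ ↦ ‖u τ‖ₑ) (g := fun τ ↦ ‖f τ‖ₑ)
      hu.1.enorm.aestronglyMeasurable hf.1.enorm.aestronglyMeasurable (by simpa using hp.le)
  have bound := (WeightedTrace.InterpolationCouple.interpNorm_le_of_ae_eq
    (φ := fun t ↦ WeightedTrace.primitive w t ^ (1 / p)) (by linarith : 0 ≤ p) hu' h).trans
      ((hardy p hp A w hw _ (hu'.add hf')).trans (mul_le_mul_right minkowski _))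
  exact ⟨⟨WeightedTrace.InterpolationCouple.mem_sum_of_ae_eq h, bound.trans_lt
    (ENNReal.mul_lt_top ENNReal.coe_lt_top (ENNReal.add_lt_top.2 ⟨hu.2, hf.2⟩))⟩, bound⟩

theorem theorem1p1 :
    ∃ C : ℝ → ℝ≥0∞ → ℝ≥0,
      ∀ (p : ℝ), 1 < p →
      ∀ (w : ℝ → ℝ≥0), WeightedTrace.IsMuckenhoupt p w →
      ∀ (X₀ X₁ Z : Type*)
        [NormedAddCommGroup X₀] [NormedSpace ℝ X₀] [CompleteSpace X₀]
        [NormedAddCommGroup X₁] [NormedSpace ℝ X₁] [CompleteSpace X₁]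
        [AddCommGroup Z] [Module ℝ Z] [TopologicalSpace Z]
        [IsTopologicalAddGroup Z] [ContinuousSMul ℝ Z] [T2Space Z]
        (E : WeightedTrace.InterpolationCouple X₀ X₁ Z)
        (u : ℝ → X₀) (f : ℝ → X₁) (u₀ : Z),
        MemLp u (ENNReal.ofReal p) (WeightedTrace.halfLineMeasure w) →
        MemLp f (ENNReal.ofReal p) (WeightedTrace.halfLineMeasure w) →
        u₀ ∈ E.sum →
        (∀ᵐ t ∂(volume.restrict (Ioi (0 : ℝ))),
          E.ι₀ (u t) = u₀ + E.ι₁ (∫ s in (0 : ℝ)..t, f s)) →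
        u₀ ∈ E.interpSpace (fun t => WeightedTrace.primitive w t ^ (1 / p)) p ∧
        E.interpNorm (fun t => WeightedTrace.primitive w t ^ (1 / p)) p u₀ ≤
          C p (WeightedTrace.apConst p w) *
            (eLpNorm u (ENNReal.ofReal p) (WeightedTrace.halfLineMeasure w) +
              eLpNorm f (ENNReal.ofReal p) (WeightedTrace.halfLineMeasure w)) := by
  obtain ⟨C, bound⟩ := theorem1p1_general
  refine ⟨fun p A ↦ C p A.toNNReal, ?_⟩
  intro p hp w hw X₀ X₁ Z _ _ _ _ _ _ _ _ _ _ _ _ E u f u₀ hu hf _ h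
  exact bound p hp _ w (hw.isCalderonWeight hp) X₀ X₁ Z E u f u₀ hu hf h
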